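/- All lattices are finite. An SPS lattice is a slim, planar, (upper) semimodular lattice; planar means that it has a Hasse diagram drawn in the plane with straight edges that meet only in elements of the lattice, and slim means that it has no three-element antichain of join-irreducible elements (for planar semimodular lattices, this is equivalent to having no sublattice $\mathsf M_3$). Let $L$ be an SPS lattice and let $S=\{o,a_l,a_r,i\}$ be a covering square of $L$, that is, $o\prec a_l\prec i$, $o\prec a_r\prec i$, $a_l\wedge a_r=o$ and $a_l\vee a_r=i$. Assume that $S$ is tight: $i$ covers exactly two elements of $L$, namely, $a_l$ and $a_r$. Let $L[S]$ be the lattice obtained by inserting a fork into $L$ at $S$. It is constructed as follows. Set $x_{l,1}=a_l$ and $y_{l,1}=o$. As long as there is an element $x_{l,k+1}$ such that, with $y_{l,k+1}=x_{l,k+1}\wedge y_{l,k}$, the set $\{y_{l,k+1},x_{l,k+1},y_{l,k},x_{l,k}\}$ is a covering square of $L$ with bottom $y_{l,k+1}$ and top $x_{l,k}$, continue with the pair $(x_{l,k+1},y_{l,k+1})$. This defines $x_{l,k},y_{l,k}$ for $1\le k\le n$. Define $x_{r,k},y_{r,k}$ for $1\le k\le m$ in the same way, starting with $x_{r,1}=a_r$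 and $y_{r,1}=o$. Then $L[S]=L\cup\{t,z_{l,1},\dots,z_{l,n},z_{r,1},\dots,z_{r,m}\}$ with new elements $t$, $z_{l,k}$, $z_{r,k}$, and its order is generated by the order of $L$ and the relations $t<i$, $z_{l,1}<t$, $z_{r,1}<t$, $y_{l,k}<z_{l,k}<x_{l,k}$, $z_{l,k+1}<z_{l,k}$, $y_{r,k}<z_{r,k}<x_{r,k}$, $z_{r,k+1}<z_{r,k}$. For a lattice $K$ and $u,v\in K$ let $\mathrm{con}_K(u,v)$ be the smallest congruence of $K$ that collapses $u$ and $v$; congruences are ordered by inclusion. Put $$\alpha_l(S)=\mathrm{con}_L(a_l,i),\qquad \alpha_r(S)=\mathrm{con}_L(a_r,i),\qquad \gamma(S)=\mathrm{con}_{L[S]}(t,i),$$ $$\overline\alpha_l(S)=\mathrm{con}_{L[S]}(a_l,i),\qquad \overline\alpha_r(S)=\mathrm{con}_{L[S]}(a_r,i).$$ Then the following hold. (1) If $[u,v]$ is a prime interval of $L$ with $\gamma(S)<\mathrm{con}_{L[S]}(u,v)$, then $\alpha_l(S)\le\mathrm{con}_L(u,v)$ or $\alpha_r(S)\le\mathrm{con}_L(u,v)$.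 (2) If $[u,v]$ is a prime interval of $L[S]$ with $\gamma(S)<\mathrm{con}_{L[S]}(u,v)$, then $\overline\alpha_l(S)\le\mathrm{con}_{L[S]}(u,v)$ or $\overline\alpha_r(S)\le\mathrm{con}_{L[S]}(u,v)$. -/

import Mathlib

/-! ## Slim planar semimodular lattices -/

/-- A planar ordered set: it has a diagram in the plane, that is, its elements can be placed at
distinct points of the plane so that smaller elements are placed lower, the edges (straight line
segments joining `a` and `b` for `a ⋖ b`) pass through no element other than their endpoints, and
two different edges meet only in elements. -/
def IsPlanarOrder (L : Type*) [PartialOrder L] : Prop :=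
  ∃ f : L → ℝ × ℝ, Function.Injective f ∧
    (∀ a b, a < b → (f a).2 < (f b).2) ∧
    (∀ a b c, a ⋖ b → f c ∈ segment ℝ (f a) (f b) → c = a ∨ c = b) ∧
    (∀ a b c d, a ⋖ b → c ⋖ d → (a, b) ≠ (c, d) →
      ∀ p ∈ segment ℝ (f a) (f b) ∩ segment ℝ (f c) (f d), ∃ e, p = f e)

/-- A slim lattice: there is no three-element antichain of join-irreducible elements. -/
def IsSlim (L : Type*) [Lattice L] : Prop :=
  ∀ p q r : L, SupIrred p → SupIrred q → SupIrred r →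
    (p ≤ q ∨ q ≤ p) ∨ (p ≤ r ∨ r ≤ p) ∨ (q ≤ r ∨ r ≤ q)

/-- An SPS lattice: a finite slim planar (upper) semimodular lattice. -/
class IsSPS (L : Type*) [Lattice L] : Prop where
  finite : Finite L
  slim : IsSlim L
  planar : IsPlanarOrder L
  semimodular : IsUpperModularLattice L

attribute [instance] IsSPS.finite IsSPS.semimodular

/-! ## Congruences -/

namespace LatticeCon

/-- Congruences of a lattice are ordered by inclusion. -/
instance instPartialOrder (K : Type*) [Lattice K] : PartialOrder (LatticeCon K) where
  le c d := ∀ x y, c.r x y → d.r x y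
  le_refl _ _ _ h := h
  le_trans _ _ _ h h' x y hxy := h' x y (h x y hxy)
  le_antisymm c d h h' := by
    obtain ⟨⟨r, _⟩, _, _⟩ := c
    obtain ⟨⟨s, _⟩, _, _⟩ := d
    have : r = s := by
      funext x y
      exact propext ⟨h x y, h' x y⟩
    subst this
    rfl

/-- `con a b`, the smallest congruence collapsing `a` and `b`. -/
def con {K : Type*} [Lattice K] (a b : K) : LatticeCon K where
  r x y := ∀ c : LatticeCon K, c.r a b → c.r x y
  iseqv := ⟨fun x c _ => c.refl x, fun h c hc => c.symm (h c hc),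
    fun h h' c hc => c.trans (h c hc) (h' c hc)⟩
  inf h h' c hc := c.inf (h c hc) (h' c hc)
  sup h h' c hc := c.sup (h c hc) (h' c hc)

end LatticeCon

/-! ## Covering squares and wings -/

/-- `{o, a, b, i}` is a covering square with bottom `o`, sides `a`, `b` and top `i`. -/
structure IsCoveringSquare {L : Type*} [Lattice L] (o a b i : L) : Prop where
  bot_covBy_left : o ⋖ a
  bot_covBy_right : o ⋖ b
  left_covBy_top : a ⋖ i
  right_covBy_top : b ⋖ i
  inf_eq : a ⊓ b = o
  sup_eq : a ⊔ b = i

/-- One step down along a wing, from the edge `(x, y)` to the edge `(x', y')` (where `y ⋖ x` and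
`y' ⋖ x'`): `{y' = x' ⊓ y, x', y, x = x' ⊔ y}` is a covering square. -/
def WingStep {L : Type*} [Lattice L] (p q : L × L) : Prop :=
  IsCoveringSquare q.2 q.1 p.2 p.1

/-- The relation "`q` is reached from `p` by finitely many (possibly no) steps down". -/
abbrev WingReach {L : Type*} [Lattice L] : L × L → L × L → Prop :=
  Relation.ReflTransGen WingStep

/-- The wing starting with the edge `y₁ = o ⋖ x₁ = a`: all the pairs `(xₖ, yₖ)` reached from
`(x₁, y₁)`. -/
def Wing {L : Type*} [Lattice L] (a o : L) : Type _ :=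
  {p : L × L // WingReach (a, o) p}

/-- A covering square `S = {o, aₗ, aᵣ, i}` of `L`, with a choice of which side is called left. -/
structure CoveringSquare (L : Type*) [Lattice L] where
  o : L
  al : L
  ar : L
  i : L
  isCoveringSquare : IsCoveringSquare o al ar i

namespace CoveringSquare

variable {L : Type*} [Lattice L]

/-- `S` is tight: the top `i` covers exactly two elements of `L`, namely, `aₗ` and `aᵣ`. -/
def IsTight (S : CoveringSquare L) : Prop :=
  ∀ x : L, x ⋖ S.i ↔ x = S.al ∨ x = S.ar

end CoveringSquare

/-- The set `F[S]` of new elements: `t`; the elements `z_{l,k}`, one for each pair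
`(x_{l,k}, y_{l,k})` of the left wing; the elements `z_{r,k}`, similarly for the right wing. -/
inductive ForkNew {L : Type*} [Lattice L] (S : CoveringSquare L) : Type _
  | t : ForkNew S
  | zl (p : Wing S.al S.o) : ForkNew S
  | zr (p : Wing S.ar S.o) : ForkNew S

/-- The underlying set `L ∪ F[S]` of the lattice `L[S]`. -/
inductive Fork {L : Type*} [Lattice L] (S : CoveringSquare L) : Type _
  | old (a : L) : Fork S
  | new (w : ForkNew S) : Fork S

namespace ForkNew

variable {L : Type*} [Lattice L] {S : CoveringSquare L}

/-- The largest element of `L` below a new element: `o` for `t`, and `yₖ` for `zₖ`. -/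
def lo : ForkNew S → L
  | t => S.o
  | zl p => p.1.2
  | zr p => p.1.2

/-- The smallest element of `L` above a new element: `i` for `t`, and `xₖ` for `zₖ`. -/
def up : ForkNew S → L
  | t => S.i
  | zl p => p.1.1
  | zr p => p.1.1

/-- The order on `F[S]`: two descending chains `z_{l,1} > z_{l,2} > ⋯` and
`z_{r,1} > z_{r,2} > ⋯` with no relations between them, and a top element `t`. -/
def Le : ForkNew S → ForkNew S → Prop
  | _, t => True
  | zl p, zl q => WingReach q.1 p.1
  | zr p, zr q => WingReach q.1 p.1
  | _, _ => False

end ForkNew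

/-- The order of `L[S]`, generated by the order of `L` and by the relations
`t < i`, `z_{l,1} < t`, `z_{r,1} < t`, `yₖ < zₖ < xₖ` and `zₖ₊₁ < zₖ` (in each wing). -/
def Fork.Le {L : Type*} [Lattice L] {S : CoveringSquare L} : Fork S → Fork S → Prop
  | .old a, .old b => a ≤ b
  | .old a, .new w => a ≤ w.lo
  | .new w, .old b => w.up ≤ b
  | .new w, .new w' => w.Le w'

/-! ## Auxiliary facts: `L[S]` is a lattice -/

namespace IsCoveringSquare

variable {L : Type*} [Lattice L] {o a b i : L}

theorem symm (h : IsCoveringSquare o a b i) : IsCoveringSquare o b a i :=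
  ⟨h.2, h.1, h.4, h.3, inf_comm b a ▸ h.5, sup_comm b a ▸ h.6⟩

theorem ne (h : IsCoveringSquare o a b i) : a ≠ b := by
  rintro rfl
  have := h.inf_eq
  rw [inf_idem] at this
  exact h.bot_covBy_left.lt.ne' this

end IsCoveringSquare

theorem CovBy.inf_eq_of_ne {L : Type*} [Lattice L] {u a b : L} (ha : u ⋖ a) (hb : u ⋖ b)
    (hne : a ≠ b) : a ⊓ b = u := by
  rcases ha.eq_or_eq (le_inf ha.le hb.le) inf_le_left with h | h
  · exact h
  · rcases hb.eq_or_eq ha.le (inf_eq_left.1 h) with h' | h'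
    · exact absurd h' ha.lt.ne'
    · exact absurd h' hne

namespace IsSPS

variable {L : Type*} [Lattice L] [IsSPS L]

theorem exists_supIrred {u c : L} (h : ¬ c ≤ u) : ∃ p, SupIrred p ∧ p ≤ c ∧ ¬ p ≤ u := by
  obtain ⟨p, ⟨hpc, hpu⟩, hmin⟩ :=
    (wellFounded_lt (α := L)).has_min {v | v ≤ c ∧ ¬ v ≤ u} ⟨c, le_rfl, h⟩
  refine ⟨p, ⟨fun hm => hpu (le_trans (hm inf_le_left) inf_le_right), ?_⟩, hpc, hpu⟩
  intro a b hab
  by_contra hcon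
  push Not at hcon
  have ha : a ≤ p := hab ▸ le_sup_left
  have hb : b ≤ p := hab ▸ le_sup_right
  have ha' : a ≤ u := by
    by_contra h'
    exact hmin a ⟨ha.trans hpc, h'⟩ (lt_of_le_of_ne ha hcon.1)
  have hb' : b ≤ u := by
    by_contra h'
    exact hmin b ⟨hb.trans hpc, h'⟩ (lt_of_le_of_ne hb hcon.2)
  exact hpu (hab ▸ sup_le ha' hb')

theorem no_three {a b c ua ub uc : L} (ha : ¬ a ≤ ua) (hb : ¬ b ≤ ub) (hc : ¬ c ≤ uc)
    (hab : a ⊓ b ≤ ua) (hab' : a ⊓ b ≤ ub) (hac : a ⊓ c ≤ ua) (hac' : a ⊓ c ≤ uc)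
    (hbc : b ⊓ c ≤ ub) (hbc' : b ⊓ c ≤ uc) : False := by
  obtain ⟨p, hp, hpa, hpu⟩ := exists_supIrred ha
  obtain ⟨q, hq, hqb, hqu⟩ := exists_supIrred hb
  obtain ⟨r, hr, hrc, hru⟩ := exists_supIrred hc
  rcases IsSPS.slim p q r hp hq hr with (h | h) | (h | h) | (h | h)
  · exact hpu ((le_inf hpa (h.trans hqb)).trans hab)
  · exact hqu ((le_inf (h.trans hpa) hqb).trans hab')
  · exact hpu ((le_inf hpa (h.trans hrc)).trans hac)
  · exact hru ((le_inf (h.trans hpa) hrc).trans hac')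
  · exact hqu ((le_inf hqb (h.trans hrc)).trans hbc)
  · exact hru ((le_inf (h.trans hqb) hrc).trans hbc')

/-- An element has at most two covers. -/
theorem covBy_two {u a b c : L} (ha : u ⋖ a) (hb : u ⋖ b) (hc : u ⋖ c) (hab : a ≠ b) :
    c = a ∨ c = b := by
  by_contra h
  push Not at h
  have h1 := ha.inf_eq_of_ne hb hab
  have h2 := ha.inf_eq_of_ne hc h.1.symm
  have h3 := hb.inf_eq_of_ne hc h.2.symm
  exact no_three (ua := u) (ub := u) (uc := u) ha.lt.not_ge hb.lt.not_ge hc.lt.not_ge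
    h1.le h1.le h2.le h2.le h3.le h3.le

theorem le_of_covers {u a b v : L} (ha : u ⋖ a) (hb : u ⋖ b) (hab : a ≠ b) (hv : u < v) :
    a ≤ v ∨ b ≤ v := by
  obtain ⟨c, hc, hcv⟩ := exists_covBy_le_of_lt hv
  rcases covBy_two ha hb hc hab with rfl | rfl
  · exact .inl hcv
  · exact .inr hcv

/-- Steps down are unique when the edge has another cover at its bottom. -/
theorem step_unique {x y c : L} {q q' : L × L} (hx : y ⋖ x) (hc : y ⋖ c) (hcx : c ≠ x)
    (h : WingStep (x, y) q) (h' : WingStep (x, y) q') : q = q' := by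
  obtain ⟨x', y'⟩ := q
  obtain ⟨x'', y''⟩ := q'
  simp only [WingStep] at h h'
  by_cases hxx : x' = x''
  · subst hxx
    rw [Prod.mk.injEq]
    exact ⟨rfl, h.inf_eq.symm.trans h'.inf_eq⟩
  exfalso
  have hyy : y' ≠ y'' := by
    rintro rfl
    rcases covBy_two h.bot_covBy_left h.bot_covBy_right h'.bot_covBy_left h.ne with e | e
    · exact hxx e.symm
    · exact h'.ne e
  have hcx' : c ⊓ x = y := hc.inf_eq_of_ne hx hcx
  have hm : x' ⊓ x'' ≤ y := by
    by_contra hmy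
    have hmw : x' ⊓ x'' ⊓ y = y' ⊓ y'' := by
      rw [← h.inf_eq, ← h'.inf_eq, inf_inf_distrib_right]
    have hwm : y' ⊓ y'' < x' ⊓ x'' := by
      refine lt_of_le_of_ne (hmw ▸ inf_le_left) fun e => hmy ?_
      rw [← e, ← hmw]
      exact inf_le_right
    have h1 : y' ⊓ y'' < y' := by
      refine lt_of_le_of_ne inf_le_left fun e => ?_
      rcases h.bot_covBy_right.eq_or_eq (inf_eq_left.1 e) h'.bot_covBy_right.le with e' | e'
      · exact hyy e'.symm
      · exact h'.bot_covBy_right.lt.ne e'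
    have h2 : y' ⊓ y'' < y'' := by
      refine lt_of_le_of_ne inf_le_right fun e => ?_
      rcases h'.bot_covBy_right.eq_or_eq (inf_eq_right.1 e) h.bot_covBy_right.le with e' | e'
      · exact hyy e'
      · exact h.bot_covBy_right.lt.ne e'
    obtain ⟨e, he, hem⟩ := exists_covBy_le_of_lt hwm
    obtain ⟨f, hf, hfm⟩ := exists_covBy_le_of_lt h1
    obtain ⟨g, hg, hgm⟩ := exists_covBy_le_of_lt h2
    have hey : ¬ e ≤ y := fun hy => he.lt.not_ge (hmw ▸ le_inf hem hy)
    have hfg : f ≠ g := by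
      rintro rfl
      exact hf.lt.not_ge (le_inf hfm hgm)
    rcases covBy_two hf hg he hfg with rfl | rfl
    · exact hey (hfm.trans h.bot_covBy_right.le)
    · exact hey (hgm.trans h'.bot_covBy_right.le)
  have hx'y : ¬ x' ≤ y := fun hle => h.bot_covBy_left.lt.not_ge (h.inf_eq ▸ le_inf le_rfl hle)
  have hx''y : ¬ x'' ≤ y :=
    fun hle => h'.bot_covBy_left.lt.not_ge (h'.inf_eq ▸ le_inf le_rfl hle)
  have e1 : x' ⊓ c ≤ y :=
    le_trans (le_inf inf_le_right (inf_le_left.trans h.left_covBy_top.le)) hcx'.le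
  have e2 : x'' ⊓ c ≤ y :=
    le_trans (le_inf inf_le_right (inf_le_left.trans h'.left_covBy_top.le)) hcx'.le
  exact no_three hx'y hx''y hc.lt.not_ge hm hm e1 e1 e2 e2

end IsSPS

namespace WingReach

variable {L : Type*} [Lattice L] {a o b : L} {p q q' : L × L}

theorem le_fst (h : WingReach p q) : q.1 ≤ p.1 := by
  induction h with
  | refl => exact le_rfl
  | tail _ hs ih => exact (show IsCoveringSquare _ _ _ _ from hs).left_covBy_top.le.trans ih

theorem le_snd (h : WingReach p q) : q.2 ≤ p.2 := by
  induction h with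
  | refl => exact le_rfl
  | tail _ hs ih => exact (show IsCoveringSquare _ _ _ _ from hs).bot_covBy_right.le.trans ih

theorem antisymm (h : WingReach p q) (h' : WingReach q p) : p = q :=
  Prod.ext (le_antisymm h'.le_fst h.le_fst) (le_antisymm h'.le_snd h.le_snd)

/-- The edges of a wing are perspective to the first one, and have another cover at the bottom. -/
theorem edge (hoa : o ⋖ a) (hob : o ⋖ b) (hab : b ≠ a) (h : WingReach (a, o) p) :
    p.1 ⊓ o = p.2 ∧ p.1 ⊔ o = a ∧ p.2 ⋖ p.1 ∧ ∃ c, p.2 ⋖ c ∧ c ≠ p.1 := by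
  induction h with
  | refl => exact ⟨inf_eq_right.2 hoa.le, sup_eq_left.2 hoa.le, hoa, b, hob, hab⟩
  | @tail p q hp hs ih =>
    have hs' : IsCoveringSquare q.2 q.1 p.2 p.1 := hs
    obtain ⟨h1, h2, -, -⟩ := ih
    refine ⟨?_, ?_, hs'.bot_covBy_left, p.2, hs'.bot_covBy_right, hs'.ne.symm⟩
    · have : q.1 ⊓ o = q.1 ⊓ (p.1 ⊓ o) := by
        rw [← inf_assoc, inf_eq_left.2 hs'.left_covBy_top.le]
      rw [this, h1, hs'.inf_eq]
    · have : p.2 ⊔ o = o := sup_eq_right.2 (le_snd hp)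
      rw [← h2, ← hs'.sup_eq, sup_assoc, this]

theorem not_fst_le (hoa : o ⋖ a) (h : WingReach (a, o) p) : ¬ p.1 ≤ o := by
  induction h with
  | refl => exact hoa.lt.not_ge
  | @tail p q hp hs ih =>
    have hs' : IsCoveringSquare q.2 q.1 p.2 p.1 := hs
    exact fun hle => ih (hs'.sup_eq ▸ sup_le hle (le_snd hp))

variable [IsSPS L]

/-- The elements of a wing form a chain. -/
theorem total (hoa : o ⋖ a) (hob : o ⋖ b) (hab : b ≠ a) (h : WingReach (a, o) p)
    (h' : WingReach (a, o) q) : WingReach p q ∨ WingReach q p := by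
  induction h with
  | refl => exact .inl h'
  | @tail p p' hp hs ih =>
    rcases ih with ih | ih
    · rcases Relation.ReflTransGen.cases_head ih with rfl | ⟨r, hr, hrq⟩
      · exact .inr (.single hs)
      · obtain ⟨-, -, h3, c, hc, hcx⟩ := edge hoa hob hab hp
        exact .inl (IsSPS.step_unique h3 hc hcx hr hs ▸ hrq)
    · exact .inr (ih.tail hs)

/-- For `u ≤ o`, the last edge before `p` in the wing whose bottom is above `u`. -/
theorem exists_last (hoa : o ⋖ a) (hob : o ⋖ b) (hab : b ≠ a) (h : WingReach (a, o) p)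
    {u : L} (hu : u ≤ o) :
    ∃ q, WingReach (a, o) q ∧ WingReach q p ∧ u ≤ q.2 ∧ q.1 ≤ u ⊔ p.1 ∧
      ∀ r, WingReach (a, o) r → WingReach r p → u ≤ r.2 → WingReach r q := by
  induction h with
  | refl => exact ⟨_, .refl, .refl, hu, le_sup_right, fun r _ h _ => h⟩
  | @tail p p' hp hs ih =>
    have hs' : IsCoveringSquare p'.2 p'.1 p.2 p.1 := hs
    by_cases hup : u ≤ p'.2
    · exact ⟨p', hp.tail hs, .refl, hup, le_sup_right, fun r _ h _ => h⟩
    obtain ⟨q, hq, hqp, huq, hqu, hlast⟩ := ih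
    refine ⟨q, hq, hqp.tail hs, huq, ?_, ?_⟩
    · have hlt : p'.2 < u ⊔ p'.2 :=
        lt_of_le_of_ne le_sup_right fun e => hup (e ▸ le_sup_left)
      have hp'o : p'.2 ≤ o := le_snd (hp.tail hs)
      rcases IsSPS.le_of_covers hs'.bot_covBy_left hs'.bot_covBy_right hs'.ne hlt with h1 | h1
      · exact absurd (h1.trans (sup_le hu hp'o)) (not_fst_le hoa (hp.tail hs))
      · refine hqu.trans (sup_le le_sup_left ?_)
        rw [← hs'.sup_eq]
        exact sup_le le_sup_right (h1.trans (sup_le_sup_left hs'.bot_covBy_left.le u))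
    · intro r hr hrp hur
      refine hlast r hr ?_ hur
      rcases total hoa hob hab hr hp with h1 | h1
      · exact h1
      · rcases Relation.ReflTransGen.cases_head h1 with rfl | ⟨r', hr', hrr⟩
        · exact .refl
        · obtain ⟨-, -, h3, c, hc, hcx⟩ := edge hoa hob hab hp
          have e := IsSPS.step_unique h3 hc hcx hr' hs
          subst e
          exact absurd (antisymm hrr hrp ▸ hur) hup

/-- Upper bounds of edges in the two different wings lie above the top of the square. -/
theorem cross {i : L} (hS : IsCoveringSquare o a b i) (hp : WingReach (a, o) p)
    (hq : WingReach (b, o) q) {c : L} (hpc : p.1 ≤ c) (hqc : q.1 ≤ c) : i ≤ c := by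
  have hoa := hS.bot_covBy_left
  have hob := hS.bot_covBy_right
  obtain ⟨q1, q2, q3, -⟩ := edge hob hoa hS.ne hq
  obtain ⟨r, hr, -, hqr, hrc, -⟩ := exists_last hoa hob hS.ne.symm hp hq.le_snd
  have hrc' : r.1 ≤ c := hrc.trans (sup_le (q3.le.trans hqc) hpc)
  have hqo : ¬ q.1 ≤ o := not_fst_le hob hq
  rcases Relation.ReflTransGen.cases_tail hr with h | ⟨s, hs, hsr⟩
  · subst h
    have hac : a ≤ c := hrc'
    rw [← hS.sup_eq]
    exact sup_le hac (q2 ▸ sup_le hqc (hoa.le.trans hac))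
  · exfalso
    have hsr' : IsCoveringSquare r.2 r.1 s.2 s.1 := hsr
    have hro : r.2 ≤ o := hr.le_snd
    have hinf : q.1 ⊓ r.2 = q.2 :=
      le_antisymm (q1 ▸ inf_le_inf_left _ hro) (le_inf q3.le hqr)
    have hcov : r.2 ⋖ q.1 ⊔ r.2 := by
      apply IsUpperModularLattice.covBy_sup_of_inf_covBy
      rw [hinf]
      exact q3
    rcases IsSPS.covBy_two hsr'.bot_covBy_left hsr'.bot_covBy_right hcov hsr'.ne with e | e
    · have h1 : q.1 ≤ a := le_trans (e ▸ le_sup_left) hr.le_fst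
      exact hqo (hS.inf_eq ▸ le_inf h1 hq.le_fst)
    · exact hqo (le_trans (e ▸ le_sup_left) (le_snd hs))

end WingReach

namespace ForkNew

variable {L : Type*} [Lattice L] {S : CoveringSquare L}

theorem lo_le (w : ForkNew S) : w.lo ≤ S.o := by
  cases w with
  | t => exact le_rfl
  | zl p => exact p.2.le_snd
  | zr p => exact p.2.le_snd

theorem lo_le_up (w : ForkNew S) : w.lo ≤ w.up := by
  have h := S.isCoveringSquare
  cases w with
  | t => exact h.bot_covBy_left.le.trans h.left_covBy_top.le
  | zl p => exact (p.2.edge h.bot_covBy_left h.bot_covBy_right h.ne.symm).2.2.1.le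
  | zr p => exact (p.2.edge h.bot_covBy_right h.bot_covBy_left h.ne).2.2.1.le

theorem not_up_le_lo (w w' : ForkNew S) : ¬ w.up ≤ w'.lo := by
  have h := S.isCoveringSquare
  intro hle
  have hle' := hle.trans w'.lo_le
  cases w with
  | t => exact (h.bot_covBy_left.lt.trans h.left_covBy_top.lt).not_ge hle'
  | zl p => exact p.2.not_fst_le h.bot_covBy_left hle'
  | zr p => exact p.2.not_fst_le h.bot_covBy_right hle'

instance : PartialOrder (ForkNew S) where
  le := Le
  le_refl w := by
    cases w with
    | t => trivial
    | zl p => exact Relation.ReflTransGen.refl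
    | zr p => exact Relation.ReflTransGen.refl
  le_trans u v w huv hvw := by
    cases u <;> cases v <;> cases w <;>
      first
      | exact trivial
      | exact False.elim huv
      | exact False.elim hvw
      | exact Relation.ReflTransGen.trans hvw huv
  le_antisymm u v huv hvu := by
    cases u <;> cases v <;>
      first
      | rfl
      | exact False.elim huv
      | exact False.elim hvu
      | exact congrArg _ (Subtype.ext (WingReach.antisymm hvu huv))

theorem lo_mono {w w' : ForkNew S} (h : w ≤ w') : w.lo ≤ w'.lo := by
  cases w <;> cases w' <;>
    first
    | exact le_rfl
    | exact lo_le _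
    | exact False.elim h
    | exact WingReach.le_snd h

theorem up_mono {w w' : ForkNew S} (h : w ≤ w') : w.up ≤ w'.up := by
  have hS := S.isCoveringSquare
  cases w with
  | t => cases w' <;> first | exact le_rfl | exact False.elim h
  | zl p =>
    cases w' with
    | t => exact p.2.le_fst.trans hS.left_covBy_top.le
    | zl q => exact WingReach.le_fst h
    | zr q => exact False.elim h
  | zr p =>
    cases w' with
    | t => exact p.2.le_fst.trans hS.right_covBy_top.le
    | zl q => exact False.elim h
    | zr q => exact WingReach.le_fst h

instance [Finite L] : Finite (ForkNew S) := by
  have : Finite (Wing S.al S.o) := Subtype.finite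
  have : Finite (Wing S.ar S.o) := Subtype.finite
  refine Finite.of_surjective
    (fun x : Unit ⊕ (Wing S.al S.o ⊕ Wing S.ar S.o) =>
      match x with
      | .inl _ => t
      | .inr (.inl p) => zl p
      | .inr (.inr p) => zr p) ?_
  intro w
  cases w with
  | t => exact ⟨.inl (), rfl⟩
  | zl p => exact ⟨.inr (.inl p), rfl⟩
  | zr p => exact ⟨.inr (.inr p), rfl⟩

end ForkNew

namespace Fork

variable {L : Type*} [Lattice L] {S : CoveringSquare L}

instance instPartialOrder : PartialOrder (Fork S) where
  le := Le
  le_refl u := by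
    cases u with
    | old a => exact le_refl a
    | new w => exact le_refl w
  le_trans u v w huv hvw := by
    cases u with
    | old a =>
      cases v with
      | old b =>
        cases w with
        | old c => exact le_trans (α := L) huv hvw
        | new z => exact le_trans (α := L) huv hvw
      | new y =>
        cases w with
        | old c => exact (le_trans (α := L) huv y.lo_le_up).trans hvw
        | new z => exact le_trans (α := L) huv (ForkNew.lo_mono hvw)
    | new x =>
      cases v with
      | old b =>
        cases w with
        | old c => exact le_trans (α := L) huv hvw
        | new z => exact absurd (le_trans (α := L) huv hvw) (ForkNew.not_up_le_lo x z)
      | new y =>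
        cases w with
        | old c => exact le_trans (α := L) (ForkNew.up_mono huv) hvw
        | new z => exact le_trans (α := ForkNew S) huv hvw
  le_antisymm u v huv hvu := by
    cases u with
    | old a =>
      cases v with
      | old b => exact congrArg old (le_antisymm (α := L) huv hvu)
      | new y => exact absurd (le_trans (α := L) hvu huv) (ForkNew.not_up_le_lo y y)
    | new x =>
      cases v with
      | old b => exact absurd (le_trans (α := L) huv hvu) (ForkNew.not_up_le_lo x x)
      | new y => exact congrArg new (le_antisymm (α := ForkNew S) huv hvu)

theorem old_le_old {a b : L} : (old a : Fork S) ≤ old b ↔ a ≤ b := Iff.rfl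
theorem old_le_new {a : L} {w : ForkNew S} : old a ≤ new w ↔ a ≤ w.lo := Iff.rfl
theorem new_le_old {a : L} {w : ForkNew S} : new w ≤ old a ↔ w.up ≤ a := Iff.rfl
theorem new_le_new {w w' : ForkNew S} : new w ≤ new w' ↔ w ≤ w' := Iff.rfl

instance [Finite L] : Finite (Fork S) := by
  refine Finite.of_surjective
    (fun x : L ⊕ ForkNew S =>
      match x with
      | .inl a => old a
      | .inr w => new w) ?_
  intro u
  cases u with
  | old a => exact ⟨.inl a, rfl⟩
  | new w => exact ⟨.inr w, rfl⟩

variable [IsSPS L]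

/-- The least new element above `w` and above the old element `a`, if there is one. -/
theorem exists_least_new (a : L) (w : ForkNew S) (h : ∃ w', w ≤ w' ∧ a ≤ w'.lo) :
    ∃ w₀, w ≤ w₀ ∧ a ≤ w₀.lo ∧ w₀.up ≤ a ⊔ w.up ∧
      ∀ w', w ≤ w' → a ≤ w'.lo → w₀ ≤ w' := by
  have hS := S.isCoveringSquare
  have hao : a ≤ S.o := by
    obtain ⟨w', -, h'⟩ := h
    exact h'.trans w'.lo_le
  cases w with
  | t => exact ⟨.t, le_rfl, hao, le_sup_right, fun w' h _ => h⟩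
  | zl p =>
    obtain ⟨q, hq, hqp, haq, hqu, hlast⟩ :=
      p.2.exists_last hS.bot_covBy_left hS.bot_covBy_right hS.ne.symm hao
    refine ⟨.zl ⟨q, hq⟩, hqp, haq, hqu, ?_⟩
    intro w' hw' haw'
    cases w' with
    | t => trivial
    | zl r => exact hlast r.1 r.2 hw' haw'
    | zr r => exact False.elim hw'
  | zr p =>
    obtain ⟨q, hq, hqp, haq, hqu, hlast⟩ :=
      p.2.exists_last hS.bot_covBy_right hS.bot_covBy_left hS.ne hao
    refine ⟨.zr ⟨q, hq⟩, hqp, haq, hqu, ?_⟩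
    intro w' hw' haw'
    cases w' with
    | t => trivial
    | zl r => exact False.elim hw'
    | zr r => exact hlast r.1 r.2 hw' haw'

theorem exists_isLUB_old_new (a : L) (w : ForkNew S) :
    ∃ s : Fork S, IsLUB {old a, new w} s := by
  by_cases h : ∃ w', w ≤ w' ∧ a ≤ w'.lo
  · obtain ⟨w₀, h1, h2, h3, h4⟩ := exists_least_new a w h
    refine ⟨new w₀, ?_, ?_⟩
    · rintro x (rfl | rfl)
      exacts [h2, h1]
    · intro x hx
      have ha : old a ≤ x := hx (.inl rfl)
      have hw : new w ≤ x := hx (.inr rfl)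
      cases x with
      | old c => exact h3.trans (sup_le ha hw)
      | new y => exact h4 y hw ha
  · refine ⟨old (a ⊔ w.up), ?_, ?_⟩
    · rintro x (rfl | rfl)
      exacts [old_le_old.2 le_sup_left, new_le_old.2 le_sup_right]
    · intro x hx
      have ha : old a ≤ x := hx (.inl rfl)
      have hw : new w ≤ x := hx (.inr rfl)
      cases x with
      | old c => exact old_le_old.2 (sup_le ha hw)
      | new y => exact absurd ⟨y, hw, ha⟩ h

theorem isLUB_of_le {K : Type*} [PartialOrder K] {u v : K} (h : u ≤ v) : IsLUB {u, v} v :=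
  ⟨by rintro x (rfl | rfl); exacts [h, le_rfl], fun _ hx => hx (.inr rfl)⟩

theorem isLUB_cross (p : Wing S.al S.o) (q : Wing S.ar S.o) :
    IsLUB {(new (.zl p) : Fork S), new (.zr q)} (new .t) := by
  refine ⟨by rintro x (rfl | rfl) <;> exact trivial, ?_⟩
  intro x hx
  have hp : new (.zl p) ≤ x := hx (.inl rfl)
  have hq : new (.zr q) ≤ x := hx (.inr rfl)
  cases x with
  | old c => exact p.2.cross S.isCoveringSquare q.2 hp hq
  | new y =>
    cases y with
    | t => exact le_rfl
    | zl r => exact False.elim hq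
    | zr r => exact False.elim hp

theorem exists_isLUB_pair (u v : Fork S) : ∃ s, IsLUB {u, v} s := by
  have hS := S.isCoveringSquare
  have comp : ∀ {u v : Fork S}, (u ≤ v ∨ v ≤ u) → ∃ s, IsLUB {u, v} s := by
    rintro u v (h | h)
    · exact ⟨v, isLUB_of_le h⟩
    · exact ⟨u, Set.pair_comm v u ▸ isLUB_of_le h⟩
  cases u with
  | old a =>
    cases v with
    | old b =>
      refine ⟨old (a ⊔ b), ?_, ?_⟩
      · rintro x (rfl | rfl)
        exacts [old_le_old.2 le_sup_left, old_le_old.2 le_sup_right]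
      · intro x hx
        have ha : old a ≤ x := hx (.inl rfl)
        have hb : old b ≤ x := hx (.inr rfl)
        cases x with
        | old c => exact old_le_old.2 (sup_le ha hb)
        | new y => exact old_le_new.2 (sup_le ha hb)
    | new w => exact exists_isLUB_old_new a w
  | new w =>
    cases v with
    | old a => exact Set.pair_comm (old a) (new w) ▸ exists_isLUB_old_new a w
    | new w' =>
      cases w with
      | t => exact comp (.inr (by cases w' <;> trivial))
      | zl p =>
        cases w' with
        | t => exact comp (.inl trivial)
        | zl q =>
          exact comp (p.2.total hS.bot_covBy_left hS.bot_covBy_right hS.ne.symm q.2).symm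
        | zr q => exact ⟨_, isLUB_cross p q⟩
      | zr p =>
        cases w' with
        | t => exact comp (.inl trivial)
        | zl q => exact ⟨_, Set.pair_comm (new (.zl q) : Fork S) (new (.zr p)) ▸ isLUB_cross q p⟩
        | zr q =>
          exact comp (p.2.total hS.bot_covBy_right hS.bot_covBy_left hS.ne q.2).symm

theorem exists_isLUB (s : Set (Fork S)) : ∃ x, IsLUB s x := by
  induction s, s.toFinite using Set.Finite.induction_on with
  | empty =>
    have : Nonempty L := ⟨S.o⟩
    obtain ⟨m, -, hm⟩ := (wellFounded_lt (α := L)).has_min Set.univ Set.univ_nonempty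
    have hbot : ∀ a, m ≤ a := fun a =>
      inf_eq_left.1 (eq_of_le_of_not_lt inf_le_left (hm (m ⊓ a) trivial))
    refine ⟨old m, by simp, ?_⟩
    intro x _
    cases x with
    | old c => exact hbot c
    | new y => exact hbot _
  | insert _ _ ih =>
    obtain ⟨x, hx⟩ := ih
    rename_i a s _ _
    obtain ⟨y, hy⟩ := exists_isLUB_pair a x
    refine ⟨y, ?_, ?_⟩
    · rintro z (rfl | hz)
      · exact hy.1 (.inl rfl)
      · exact (hx.1 hz).trans (hy.1 (.inr rfl))
    · intro z hz
      refine hy.2 ?_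
      rintro w (rfl | rfl)
      · exact hz (.inl rfl)
      · exact hx.2 fun v hv => hz (.inr hv)

theorem exists_isGLB_pair (u v : Fork S) : ∃ s, IsGLB {u, v} s := by
  obtain ⟨x, hx⟩ := exists_isLUB (lowerBounds {u, v})
  exact ⟨x, isLUB_lowerBounds.1 hx⟩

/-- The lattice `L[S]`. -/
noncomputable instance instLattice : Lattice (Fork S) where
  __ := instPartialOrder
  sup u v := (exists_isLUB_pair u v).choose
  le_sup_left u v := (exists_isLUB_pair u v).choose_spec.1 (.inl rfl)
  le_sup_right u v := (exists_isLUB_pair u v).choose_spec.1 (.inr rfl)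
  sup_le u v w hu hv := (exists_isLUB_pair u v).choose_spec.2 (by rintro x (rfl | rfl) <;> assumption)
  inf u v := (exists_isGLB_pair u v).choose
  inf_le_left u v := (exists_isGLB_pair u v).choose_spec.1 (.inl rfl)
  inf_le_right u v := (exists_isGLB_pair u v).choose_spec.1 (.inr rfl)
  le_inf u v w hu hv := (exists_isGLB_pair v w).choose_spec.2 (by rintro x (rfl | rfl) <;> assumption)

end Fork

/-! ## The congruences `αₗ(S)`, `αᵣ(S)` of `L`, their extensions to `L[S]`, and `γ(S)` -/

namespace CoveringSquare

variable {L : Type*} [Lattice L]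

/-- `αₗ(S) = con(aₗ, i)` in `L`. -/
def alphaL (S : CoveringSquare L) : LatticeCon L := LatticeCon.con S.al S.i

/-- `αᵣ(S) = con(aᵣ, i)` in `L`. -/
def alphaR (S : CoveringSquare L) : LatticeCon L := LatticeCon.con S.ar S.i

variable [IsSPS L]

/-- `con(aₗ, i)` in `L[S]`. -/
noncomputable def alphaLExt (S : CoveringSquare L) : LatticeCon (Fork S) :=
  LatticeCon.con (Fork.old S.al) (Fork.old S.i)

/-- `con(aᵣ, i)` in `L[S]`. -/
noncomputable def alphaRExt (S : CoveringSquare L) : LatticeCon (Fork S) :=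
  LatticeCon.con (Fork.old S.ar) (Fork.old S.i)

/-- `γ(S) = con(t, i)` in `L[S]`. -/
noncomputable def gamma (S : CoveringSquare L) : LatticeCon (Fork S) :=
  LatticeCon.con (Fork.new ForkNew.t) (Fork.old S.i)

end CoveringSquare

/-! Both parts are proved by contraposition. Say that a congruence `c` of `L` separates `S` if it
collapses neither `aₗ, i` nor `aᵣ, i`. Then the ideal below `o` is a union of classes of `c`, since
an element has at most two covers, and so is the filter above `i`, since `S` is tight.

For (1), if `c = con(u, v)` separates `S`, it extends to `L[S]`: two elements are related when both
are old or both are new and their least old upper bounds are congruent modulo `c` (`ExtRel`,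
`extend`). This extension collapses `u, v` but never a new element with an old one. Hence it does
not collapse `t, i`, and `γ(S)` is not below `con(u, v)`. The main work is `ExtRel.inf`: least old
upper bounds do not commute with meets, so a meet that is new must be located in the fork. The
union-of-classes facts and tightness show that congruent pairs have their new meets both equal to
`t` or both in the same wing; there, perspectivity carries congruence of lower edge ends to upper
ones.

For (2), let the restriction to `L` of `c = con(u, v)` separate `S`. The part of `c` that does not
cross the boundary of the ideal below `t` is again a congruence (`respectingT`), and it does not
collapse `t, i`. If `u, v` lie on the same side of that boundary, this excludes `γ(S) ≤ c`. If they
lie on different sides, the prime interval `[u, v]` is collapsed by `γ(S)` (`gamma_of_covBy`), so `c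
≤ γ(S)`, against strictness. -/

/-! ### Congruences that separate the upper edges of a covering square -/

namespace CoveringSquare

variable {L : Type*} [Lattice L]

/-- A congruence separating the upper edges of a covering square. -/
structure Separates (S : CoveringSquare L) (c : LatticeCon L) : Prop where
  left : ¬ c.r S.al S.i
  right : ¬ c.r S.ar S.i

variable {S : CoveringSquare L} {c : LatticeCon L}

theorem Separates.not_left_right (h : S.Separates c) : ¬ c.r S.al S.ar := fun hc => by
  have := c.sup (c.refl S.al) hc
  rw [sup_idem, S.isCoveringSquare.sup_eq] at this
  exact h.left this

/-- If a class left the ideal below `o`, joining with `o` would make `o` congruent to an element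
strictly above it, hence above `aₗ` or `aᵣ`. Meeting with that side `a` gives `o ≡ a`, and joining
with the other side `b` gives `b ≡ i`. -/
theorem Separates.le_bot [IsSPS L] (h : S.Separates c) {s s' : L} (hc : c.r s s')
    (hs : s ≤ S.o) : s' ≤ S.o := by
  have hS := S.isCoveringSquare
  by_contra hs'
  have h1 : c.r S.o (s' ⊔ S.o) := by
    simpa [sup_eq_right.2 hs] using c.sup hc (c.refl S.o)
  have key : ∀ a b, S.o ≤ a → S.o ≤ b → a ≤ s' ⊔ S.o → a ⊔ b = S.i → c.r b S.i := by
    intro a b ha hb hle hab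
    have h2 := c.sup (c.inf h1 (c.refl a)) (c.refl b)
    rwa [inf_eq_left.2 ha, inf_eq_right.2 hle, sup_eq_right.2 hb, hab] at h2
  have hlt : S.o < s' ⊔ S.o := lt_of_le_of_ne le_sup_right fun e => hs' (e ▸ le_sup_left)
  rcases IsSPS.le_of_covers hS.bot_covBy_left hS.bot_covBy_right hS.ne hlt with hle | hle
  · exact h.right (key _ _ hS.bot_covBy_left.le hS.bot_covBy_right.le hle hS.sup_eq)
  · exact h.left (key _ _ hS.bot_covBy_right.le hS.bot_covBy_left.le hle hS.symm.sup_eq)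

theorem Separates.le_bot_iff [IsSPS L] (h : S.Separates c) {s s' : L} (hc : c.r s s') :
    s ≤ S.o ↔ s' ≤ S.o :=
  ⟨h.le_bot hc, h.le_bot (c.symm hc)⟩

/-- Below `i`, every element other than `i` lies under a lower cover of `i`, and tightness names
these covers. -/
theorem IsTight.le_side [Finite L] (hS : S.IsTight) {s : L} (hs : ¬ S.i ≤ s) :
    s ⊓ S.i ≤ S.al ∨ s ⊓ S.i ≤ S.ar := by
  have hlt : s ⊓ S.i < S.i := lt_of_le_of_ne inf_le_right fun e => hs (inf_eq_right.1 e)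
  obtain ⟨d, hd, hdi⟩ := exists_le_covBy_of_lt hlt
  rcases (hS d).1 hdi with rfl | rfl
  exacts [.inl hd, .inr hd]

/-- Dual in spirit to `Separates.le_bot`: a class leaving the filter above `i` makes `i` congruent
to an element under some side `a`, and joining with `a` collapses `a, i`. -/
theorem Separates.top_le [Finite L] (h : S.Separates c) (hS : S.IsTight) {s s' : L}
    (hc : c.r s s') (hs : S.i ≤ s) : S.i ≤ s' := by
  by_contra hs'
  have h1 : c.r S.i (s' ⊓ S.i) := by
    simpa [inf_eq_right.2 hs] using c.inf hc (c.refl S.i)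
  have key : ∀ a, a ≤ S.i → s' ⊓ S.i ≤ a → c.r a S.i := by
    intro a ha hle
    have h2 := c.sup h1 (c.refl a)
    rw [sup_eq_left.2 ha, sup_eq_right.2 hle] at h2
    exact c.symm h2
  rcases hS.le_side hs' with hle | hle
  · exact h.left (key _ S.isCoveringSquare.left_covBy_top.le hle)
  · exact h.right (key _ S.isCoveringSquare.right_covBy_top.le hle)

/-- An element that meets the top of a covering square inside its bottom lies below the bottom. -/
theorem le_bot_of_inf_top_le [IsSPS L] (S : CoveringSquare L) {b : L} (h : b ⊓ S.i ≤ S.o) :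
    b ≤ S.o := by
  have hS := S.isCoveringSquare
  by_contra hb
  have hl : S.al ⊓ b ≤ S.o :=
    (le_inf inf_le_right (inf_le_left.trans hS.left_covBy_top.le)).trans h
  have hr : S.ar ⊓ b ≤ S.o :=
    (le_inf inf_le_right (inf_le_left.trans hS.right_covBy_top.le)).trans h
  -- Otherwise `aₗ`, `aᵣ`, `b` are three elements outside the ideal below `o` whose pairwise meets
  -- lie inside it, which slimness forbids.
  exact IsSPS.no_three hS.bot_covBy_left.lt.not_ge hS.bot_covBy_right.lt.not_ge hb
    hS.inf_eq.le hS.inf_eq.le hl hl hr hr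

end CoveringSquare

namespace LatticeCon

variable {K : Type*} [Lattice K]

theorem con_le_iff {a b : K} {c : LatticeCon K} : con a b ≤ c ↔ c.r a b :=
  ⟨fun h => h a b fun _ hd => hd, fun h _ _ hxy => hxy c h⟩

theorem con_self (a b : K) : (con a b).r a b := fun _ h => h

end LatticeCon

/-! ### Descending along a wing -/

/-- An element below the top but not below the bottom of a prime interval `y ⋖ x` is above the
top of an edge reached from it by steps down. -/
theorem WingReach.exists_fst_le {L : Type*} [Lattice L] [Finite L] [IsUpperModularLattice L]
    {x y s : L} (hyx : y ⋖ x) (hsx : s ≤ x) (hsy : ¬ s ≤ y) :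
    ∃ r : L × L, WingReach (x, y) r ∧ r.1 ≤ s := by
  -- Climbing from `m` to `y` through covers, semimodularity turns each step into a covering square,
  -- so the edge `m ⋖ s` is pushed up to the edge `y ⋖ s ⊔ y`.
  have ladder : ∀ m s : L, m ≤ y → m ⋖ s → ¬ s ≤ y → WingReach (s ⊔ y, y) (s, m) := by
    intro m
    induction m using WellFoundedGT.induction with
    | ind m ih =>
      intro s hmy hms hsy
      rcases hmy.eq_or_lt with rfl | hlt
      · rw [sup_eq_left.2 hms.le]
      · obtain ⟨m', hmm', hm'y⟩ := exists_covBy_le_of_lt hlt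
        have hne : s ≠ m' := fun e => hsy (e ▸ hm'y)
        have hinf : s ⊓ m' = m := hms.inf_eq_of_ne hmm' hne
        have h1 : m' ⋖ s ⊔ m' :=
          IsUpperModularLattice.covBy_sup_of_inf_covBy (by rw [hinf]; exact hms)
        have h2 : s ⋖ s ⊔ m' := by
          rw [sup_comm]
          exact IsUpperModularLattice.covBy_sup_of_inf_covBy (by rw [inf_comm, hinf]; exact hmm')
        have h3 := ih m' hmm'.lt (s ⊔ m') hm'y h1 fun h => hsy (le_sup_left.trans h)
        rw [sup_assoc, sup_eq_right.2 hm'y] at h3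
        exact h3.tail (show IsCoveringSquare _ _ _ _ from ⟨hms, hmm', h2, h1, hinf, rfl⟩)
  have hlt : s ⊓ y < s := lt_of_le_of_ne inf_le_left fun e => hsy (inf_eq_left.1 e)
  obtain ⟨s₁, hs₁, hs₁s⟩ := exists_covBy_le_of_lt hlt
  have hs₁y : ¬ s₁ ≤ y := fun h => hs₁.lt.not_ge (le_inf hs₁s h)
  refine ⟨(s₁, s ⊓ y), ?_, hs₁s⟩
  have hx : s₁ ⊔ y = x := by
    rcases hyx.eq_or_eq le_sup_right (sup_le (hs₁s.trans hsx) hyx.le) with h | h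
    · exact absurd (h ▸ le_sup_left) hs₁y
    · exact h
  exact hx ▸ ladder _ s₁ inf_le_right hs₁ hs₁y

/-! ### Old neighbours of the new elements -/

namespace ForkNew

variable {L : Type*} [Lattice L] {S : CoveringSquare L}

theorem le_t (w : ForkNew S) : w ≤ t := by cases w <;> trivial

theorem lo_eq (w : ForkNew S) : w.lo = w.up ⊓ S.o := by
  have h := S.isCoveringSquare
  cases w with
  | t => exact (inf_eq_right.2 (h.bot_covBy_left.le.trans h.left_covBy_top.le)).symm
  | zl p => exact (p.2.edge h.bot_covBy_left h.bot_covBy_right h.ne.symm).1.symm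
  | zr p => exact (p.2.edge h.bot_covBy_right h.bot_covBy_left h.ne).1.symm

theorem not_up_le (w : ForkNew S) : ¬ w.up ≤ S.o := not_up_le_lo w t

theorem up_le (w : ForkNew S) : w.up ≤ S.i := up_mono w.le_t

theorem up_zl_sup (p : Wing S.al S.o) : (zl p).up ⊔ S.o = S.al :=
  have h := S.isCoveringSquare
  (p.2.edge h.bot_covBy_left h.bot_covBy_right h.ne.symm).2.1

theorem up_zr_sup (p : Wing S.ar S.o) : (zr p).up ⊔ S.o = S.ar :=
  have h := S.isCoveringSquare
  (p.2.edge h.bot_covBy_right h.bot_covBy_left h.ne).2.1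

theorem up_zl_le (p : Wing S.al S.o) : (zl p).up ≤ S.al := up_zl_sup p ▸ le_sup_left

theorem up_zr_le (p : Wing S.ar S.o) : (zr p).up ≤ S.ar := up_zr_sup p ▸ le_sup_left

/-- If `w ≤ w'` are different from `t`, then the edges of `w` and `w'` are perspective. -/
theorem up_eq_of_le {w w' : ForkNew S} (hw : w' ≠ t) (h : w ≤ w') : w'.up = w.up ⊔ w'.lo := by
  have hS := S.isCoveringSquare
  have key : ∀ {a b : L}, S.o ⋖ a → S.o ⋖ b → b ≠ a → ∀ {p q : L × L}, WingReach (a, S.o) p →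
      WingReach p q → p.1 = q.1 ⊔ p.2 := by
    intro a b ha hb hba p q hp hpq
    obtain ⟨h1, -, h3, -⟩ := hp.edge ha hb hba
    rcases h3.eq_or_eq (le_sup_right : p.2 ≤ q.1 ⊔ p.2) (sup_le hpq.le_fst h3.le) with e | e
    · exact absurd ((le_sup_left.trans e.le).trans hp.le_snd)
        (WingReach.not_fst_le ha (hp.trans hpq))
    · exact e.symm
  cases w with
  | t => cases w' <;> first | exact absurd rfl hw | exact False.elim h
  | zl p =>
    cases w' with
    | t => exact absurd rfl hw
    | zl q => exact key hS.bot_covBy_left hS.bot_covBy_right hS.ne.symm q.2 h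
    | zr q => exact False.elim h
  | zr p =>
    cases w' with
    | t => exact absurd rfl hw
    | zl q => exact False.elim h
    | zr q => exact key hS.bot_covBy_right hS.bot_covBy_left hS.ne q.2 h

/-- Perspectivity: joining with `w.up` sends `w.lo` to `w.up` and `w'.lo` to `w'.up`. -/
theorem con_up_of_con_lo {c : LatticeCon L} {w w' : ForkNew S} (hw : w' ≠ t) (h : w ≤ w')
    (hc : c.r w.lo w'.lo) : c.r w.up w'.up := by
  have := c.sup (c.refl w.up) hc
  rwa [sup_eq_left.2 w.lo_le_up, ← up_eq_of_le hw h] at this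

variable [IsSPS L]

theorem zl_total (p q : Wing S.al S.o) : zl p ≤ zl q ∨ zl q ≤ zl p :=
  have hS := S.isCoveringSquare
  (p.2.total hS.bot_covBy_left hS.bot_covBy_right hS.ne.symm q.2).symm

theorem zr_total (p q : Wing S.ar S.o) : zr p ≤ zr q ∨ zr q ≤ zr p :=
  have hS := S.isCoveringSquare
  (p.2.total hS.bot_covBy_right hS.bot_covBy_left hS.ne q.2).symm

/-- An old element `b` with `w.up ⊓ b ≰ o` is above a new element below `w`. -/
theorem exists_le_of_not_le (hS : S.IsTight) (w : ForkNew S) {b : L} (hb : ¬ w.up ⊓ b ≤ S.o) :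
    ∃ w' ≤ w, w'.up ≤ b := by
  have h := S.isCoveringSquare
  have left : ∀ p : Wing S.al S.o, ¬ (zl p).up ⊓ b ≤ S.o → ∃ w' ≤ zl p, w'.up ≤ b := by
    intro p hp
    obtain ⟨r, hr, hrs⟩ := WingReach.exists_fst_le
      (p.2.edge h.bot_covBy_left h.bot_covBy_right h.ne.symm).2.2.1 inf_le_left
      fun hle => hp (hle.trans p.2.le_snd)
    exact ⟨zl ⟨r, p.2.trans hr⟩, hr, hrs.trans inf_le_right⟩
  have right : ∀ p : Wing S.ar S.o, ¬ (zr p).up ⊓ b ≤ S.o → ∃ w' ≤ zr p, w'.up ≤ b := by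
    intro p hp
    obtain ⟨r, hr, hrs⟩ := WingReach.exists_fst_le
      (p.2.edge h.bot_covBy_right h.bot_covBy_left h.ne).2.2.1 inf_le_left
      fun hle => hp (hle.trans p.2.le_snd)
    exact ⟨zr ⟨r, p.2.trans hr⟩, hr, hrs.trans inf_le_right⟩
  cases w with
  | zl p => exact left p hb
  | zr p => exact right p hb
  | t =>
    by_cases hi : S.i ≤ b
    · exact ⟨t, le_rfl, hi⟩
    -- When `b` is not above `i`, its meet with `i` lies under a side, which is the top of the first
    -- edge of that wing, so the wing case applies to `z₁`.
    rcases hS.le_side hi with hle | hle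
    · obtain ⟨w', -, h'⟩ := left ⟨_, .refl⟩ fun hl =>
        hb (le_trans (le_inf (le_trans (le_of_eq (inf_comm _ _)) hle) inf_le_right) hl)
      exact ⟨w', w'.le_t, h'⟩
    · obtain ⟨w', -, h'⟩ := right ⟨_, .refl⟩ fun hl =>
        hb (le_trans (le_inf (le_trans (le_of_eq (inf_comm _ _)) hle) inf_le_right) hl)
      exact ⟨w', w'.le_t, h'⟩

end ForkNew

/-! ### Joins and meets in `L[S]` -/

namespace Fork

variable {L : Type*} [Lattice L] {S : CoveringSquare L}

/-- The least old element above `x`. -/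
def upper : Fork S → L
  | old a => a
  | new w => w.up

/-- The largest old element below `x`. -/
def lower : Fork S → L
  | old a => a
  | new w => w.lo

/-- `x` is one of the elements added to `L`. -/
def IsNew : Fork S → Prop
  | old _ => False
  | new _ => True

theorem IsNew.exists_eq {x : Fork S} (h : x.IsNew) : ∃ w, x = new w := by
  cases x with
  | old a => exact h.elim
  | new w => exact ⟨w, rfl⟩

theorem exists_eq_old {x : Fork S} (h : ¬ x.IsNew) : ∃ a, x = old a := by
  cases x with
  | old a => exact ⟨a, rfl⟩
  | new w => exact absurd trivial h

theorem upper_le_iff {x : Fork S} {a : L} : x.upper ≤ a ↔ x ≤ old a := by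
  cases x <;> exact Iff.rfl

theorem le_lower_iff {x : Fork S} {a : L} : a ≤ x.lower ↔ old a ≤ x := by
  cases x <;> exact Iff.rfl

theorem le_t_iff {x : Fork S} : x ≤ new .t ↔ x.IsNew ∨ x.upper ≤ S.o := by
  cases x with
  | old a => exact ⟨.inr, fun h => h.elim False.elim id⟩
  | new w => exact ⟨fun _ => .inl trivial, fun _ => w.le_t⟩

theorem t_le_iff {x : Fork S} : new .t ≤ x ↔ S.i ≤ x.upper := by
  cases x with
  | old a => exact Iff.rfl
  | new w =>
    refine ⟨fun h => ForkNew.up_mono h, fun h => ?_⟩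
    have hS := S.isCoveringSquare
    cases w with
    | t => exact le_rfl
    | zl p => exact absurd (h.trans (ForkNew.up_zl_le p)) hS.left_covBy_top.lt.not_ge
    | zr p => exact absurd (h.trans (ForkNew.up_zr_le p)) hS.right_covBy_top.lt.not_ge

/-- The set of new elements is convex, because no `w.up` lies below any `w'.lo`. -/
theorem isNew_of_le_of_le {x : Fork S} {w w' : ForkNew S} (h : new w ≤ x) (h' : x ≤ new w') :
    x.IsNew := by
  cases x with
  | old a => exact ForkNew.not_up_le_lo w w' (le_trans (α := L) h h')
  | new w => trivial

/-- `x` and `y` are both old or both new, and their upper old neighbours are congruent. -/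
def ExtRel (c : LatticeCon L) (x y : Fork S) : Prop :=
  (x.IsNew ↔ y.IsNew) ∧ c.r x.upper y.upper

/-- For a new `w`, `w.lo = w.up ⊓ o`, so congruence passes from upper to lower neighbours by meeting
with `o`. This is why `ExtRel` is stated with upper ones. -/
theorem ExtRel.con_lower {c : LatticeCon L} {x y : Fork S} (h : ExtRel c x y) : c.r x.lower y.lower := by
  cases x with
  | old a =>
    cases y with
    | old b => exact h.2
    | new w => exact (h.1.2 trivial).elim
  | new w =>
    cases y with
    | old b => exact (h.1.1 trivial).elim
    | new w' =>
      change c.r w.lo w'.lo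
      rw [w.lo_eq, w'.lo_eq]
      exact c.inf h.2 (c.refl _)

variable [IsSPS L]

/-- The embedding `old` has `upper` as left adjoint and `lower` as right adjoint. Hence `L` is a
sublattice, `upper` preserves joins and `lower` preserves meets. -/
theorem old_inf (a b : L) : (old (a ⊓ b) : Fork S) = old a ⊓ old b := by
  refine eq_of_forall_le_iff fun x => ?_
  rw [le_inf_iff, ← upper_le_iff, ← upper_le_iff, ← upper_le_iff, le_inf_iff]

theorem old_sup (a b : L) : (old (a ⊔ b) : Fork S) = old a ⊔ old b := by
  refine eq_of_forall_ge_iff fun x => ?_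
  rw [sup_le_iff, ← le_lower_iff, ← le_lower_iff, ← le_lower_iff, sup_le_iff]

theorem upper_sup (x y : Fork S) : (x ⊔ y).upper = x.upper ⊔ y.upper := by
  refine eq_of_forall_ge_iff fun a => ?_
  simp only [upper_le_iff, sup_le_iff]

theorem lower_inf (x y : Fork S) : (x ⊓ y).lower = x.lower ⊓ y.lower := by
  refine eq_of_forall_le_iff fun a => ?_
  simp only [le_lower_iff, le_inf_iff]

theorem isNew_sup_iff {x y : Fork S} :
    (x ⊔ y).IsNew ↔ (x.IsNew ∨ y.IsNew) ∧ x ≤ new .t ∧ y ≤ new .t := by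
  constructor
  · intro h
    refine ⟨?_, sup_le_iff.1 (le_t_iff.2 (.inl h))⟩
    by_contra hxy
    push Not at hxy
    obtain ⟨a, rfl⟩ := exists_eq_old hxy.1
    obtain ⟨b, rfl⟩ := exists_eq_old hxy.2
    rw [← old_sup] at h
    exact h
  · rintro ⟨h | h, hxy⟩
    · obtain ⟨w, rfl⟩ := h.exists_eq
      exact isNew_of_le_of_le le_sup_left (sup_le_iff.2 hxy)
    · obtain ⟨w, rfl⟩ := h.exists_eq
      exact isNew_of_le_of_le le_sup_right (sup_le_iff.2 hxy)

/-- Together with `isNew_sup_iff`, this expresses newness through data that `ExtRel` controls. A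
meet is new exactly when some new element fits below it, and `exists_le_of_not_le` supplies one when
a factor is old. -/
theorem isNew_inf_iff (hS : S.IsTight) {x y : Fork S} :
    (x ⊓ y).IsNew ↔ (x.IsNew ∨ y.IsNew) ∧ ¬ x.upper ⊓ y.upper ≤ S.o := by
  have hSq := S.isCoveringSquare
  constructor
  · intro h
    constructor
    · by_contra hxy
      push Not at hxy
      obtain ⟨a, rfl⟩ := exists_eq_old hxy.1
      obtain ⟨b, rfl⟩ := exists_eq_old hxy.2
      rw [← old_inf] at h
      exact h
    · obtain ⟨w, hw⟩ := h.exists_eq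
      intro hle
      have h1 : new w ≤ old x.upper := (hw ▸ inf_le_left).trans (upper_le_iff.1 le_rfl)
      have h2 : new w ≤ old y.upper := (hw ▸ inf_le_right).trans (upper_le_iff.1 le_rfl)
      exact w.not_up_le ((le_inf (new_le_old.1 h1) (new_le_old.1 h2)).trans hle)
  · have key : ∀ {w : ForkNew S} {y : Fork S}, ¬ w.up ⊓ y.upper ≤ S.o → (new w ⊓ y).IsNew := by
      intro w y hle
      cases y with
      | old b =>
        obtain ⟨w', h1, h2⟩ := w.exists_le_of_not_le hS hle
        exact isNew_of_le_of_le (le_inf (new_le_new.2 h1) (new_le_old.2 h2)) inf_le_left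
      | new w' =>
        have comp : (w ≤ w' ∨ w' ≤ w) → (new w ⊓ new w' : Fork S).IsNew := by
          rintro (h | h)
          · rw [inf_eq_left.2 (new_le_new.2 h)]; trivial
          · rw [inf_eq_right.2 (new_le_new.2 h)]; trivial
        cases w with
        | t => exact comp (.inr w'.le_t)
        | zl p =>
          cases w' with
          | t => exact comp (.inl (ForkNew.le_t _))
          | zl q => exact comp (ForkNew.zl_total p q)
          | zr q =>
            exact absurd ((inf_le_inf (ForkNew.up_zl_le p) (ForkNew.up_zr_le q)).trans
              hSq.inf_eq.le) hle
        | zr p =>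
          cases w' with
          | t => exact comp (.inl (ForkNew.le_t _))
          | zl q =>
            exact absurd ((inf_le_inf (ForkNew.up_zr_le p) (ForkNew.up_zl_le q)).trans
              hSq.symm.inf_eq.le) hle
          | zr q => exact comp (ForkNew.zr_total p q)
    rintro ⟨h | h, hle⟩
    · obtain ⟨w, rfl⟩ := h.exists_eq
      exact key hle
    · obtain ⟨w, rfl⟩ := h.exists_eq
      rw [inf_comm] at hle ⊢
      exact key hle

/-! ### Passing congruences between `L` and `L[S]` -/

/-- The restriction of a congruence of `L[S]` to `L`. -/
def restrict (c : LatticeCon (Fork S)) : LatticeCon L where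
  r a b := c.r (old a) (old b)
  iseqv := ⟨fun _ => c.refl _, fun h => c.symm h, fun h h' => c.trans h h'⟩
  inf h h' := by rw [old_inf, old_inf]; exact c.inf h h'
  sup h h' := by rw [old_sup, old_sup]; exact c.sup h h'

/-- The part of a congruence of `L[S]` that respects the ideal generated by `t`. -/
def respectingT (c : LatticeCon (Fork S)) (hc : S.Separates (restrict c)) :
    LatticeCon (Fork S) where
  r x y := c.r x y ∧ (x ≤ new .t ↔ y ≤ new .t)
  iseqv := ⟨fun _ => ⟨c.refl _, Iff.rfl⟩, fun h => ⟨c.symm h.1, h.2.symm⟩,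
    fun h h' => ⟨c.trans h.1 h'.1, h.2.trans h'.2⟩⟩
  sup h h' := ⟨c.sup h.1 h'.1, by rw [sup_le_iff, sup_le_iff, h.2, h'.2]⟩
  inf := by
    intro w x y z h h'
    refine ⟨c.inf h.1 h'.1, ?_⟩
    by_cases hw : w ≤ new .t
    · exact iff_of_true (inf_le_left.trans hw) (inf_le_left.trans (h.2.1 hw))
    by_cases hy : y ≤ new .t
    · exact iff_of_true (inf_le_right.trans hy) (inf_le_right.trans (h'.2.1 hy))
    have hx := fun hx => hw (h.2.2 hx)
    have hz := fun hz => hy (h'.2.2 hz)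
    -- Once neither factor is below `t`, on either side, all four elements are old. Their meets are
    -- old too, and an old element is below `t` exactly when it is below `o`.
    have isOld : ∀ {x : Fork S}, ¬ x ≤ new .t → ∃ a, x = old a :=
      fun h => exists_eq_old fun hn => h (le_t_iff.2 (.inl hn))
    obtain ⟨a, rfl⟩ := isOld hw
    obtain ⟨b, rfl⟩ := isOld hx
    obtain ⟨a', rfl⟩ := isOld hy
    obtain ⟨b', rfl⟩ := isOld hz
    rw [← old_inf, ← old_inf]
    exact hc.le_bot_iff ((restrict c).inf h.1 h'.1)

namespace ExtRel

variable {c : LatticeCon L} {x y x' y' : Fork S}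

theorem le_t_iff (hc : S.Separates c) (h : ExtRel c x y) : x ≤ new .t ↔ y ≤ new .t := by
  rw [Fork.le_t_iff, Fork.le_t_iff, h.1, hc.le_bot_iff h.2]

theorem sup (hc : S.Separates c) (h : ExtRel c x y) (h' : ExtRel c x' y') :
    ExtRel c (x ⊔ x') (y ⊔ y') := by
  refine ⟨?_, ?_⟩
  · rw [isNew_sup_iff, isNew_sup_iff, h.1, h'.1, h.le_t_iff hc, h'.le_t_iff hc]
  · rw [upper_sup, upper_sup]
    exact c.sup h.2 h'.2

/-- Lower neighbours of the meets are congruent because `lower` preserves meets. It remains to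
recover the upper ones, which needs both meets to sit in corresponding places of the fork. -/
theorem inf (hS : S.IsTight) (hc : S.Separates c) (h : ExtRel c x y) (h' : ExtRel c x' y') :
    ExtRel c (x ⊓ x') (y ⊓ y') := by
  have hSq := S.isCoveringSquare
  have hcinf := c.inf h.2 h'.2
  have hnew : (x ⊓ x').IsNew ↔ (y ⊓ y').IsNew := by
    rw [isNew_inf_iff hS, isNew_inf_iff hS, h.1, h'.1, hc.le_bot_iff hcinf]
  refine ⟨hnew, ?_⟩
  have hlow : c.r (x ⊓ x').lower (y ⊓ y').lower := by
    rw [lower_inf, lower_inf]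
    exact c.inf h.con_lower h'.con_lower
  by_cases hn : (x ⊓ x').IsNew
  swap
  · obtain ⟨a, ha⟩ := exists_eq_old hn
    obtain ⟨b, hb⟩ := exists_eq_old fun hb => hn (hnew.2 hb)
    rw [ha, hb] at hlow ⊢
    exact hlow
  obtain ⟨w, hw⟩ := hn.exists_eq
  obtain ⟨w', hw'⟩ := (hnew.1 hn).exists_eq
  rw [hw, hw'] at hlow ⊢
  change c.r w.lo w'.lo at hlow
  change c.r w.up w'.up
  have hcomp : ∀ {w w' : ForkNew S}, w ≠ .t → w' ≠ .t → (w ≤ w' ∨ w' ≤ w) →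
      c.r w.lo w'.lo → c.r w.up w'.up := by
    rintro w w' hw hw' (hle | hle) hlo
    · exact ForkNew.con_up_of_con_lo hw' hle hlo
    · exact c.symm (ForkNew.con_up_of_con_lo hw hle (c.symm hlo))
  have htt : S.i ≤ x.upper ⊓ x'.upper ↔ S.i ≤ y.upper ⊓ y'.upper :=
    ⟨hc.top_le hS hcinf, hc.top_le hS (c.symm hcinf)⟩
  have htw : w = .t ↔ S.i ≤ x.upper ⊓ x'.upper := by
    rw [le_inf_iff, ← t_le_iff, ← t_le_iff, ← le_inf_iff, hw]
    exact ⟨fun e => e ▸ le_rfl, fun hle => le_antisymm w.le_t (new_le_new.1 hle)⟩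
  have htw' : w' = .t ↔ S.i ≤ y.upper ⊓ y'.upper := by
    rw [le_inf_iff, ← t_le_iff, ← t_le_iff, ← le_inf_iff, hw']
    exact ⟨fun e => e ▸ le_rfl, fun hle => le_antisymm w'.le_t (new_le_new.1 hle)⟩
  have up_le : ∀ {w : ForkNew S} {x x' : Fork S}, x ⊓ x' = new w →
      w.up ≤ x.upper ⊓ x'.upper := by
    intro w x x' hw
    exact le_inf (new_le_old.1 ((hw ▸ inf_le_left).trans (upper_le_iff.1 le_rfl)))
      (new_le_old.1 ((hw ▸ inf_le_right).trans (upper_le_iff.1 le_rfl)))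
  -- The wing containing a new meet can be read off from `s`, the meet of the upper neighbours: `s ⊓
  -- i` lies under one side by tightness, and not under `aᵣ`, as then `(zl p).up ≤ aₗ ⊓ aᵣ = o`.
  have left_side : ∀ {p : Wing S.al S.o} {s : L}, ¬ S.i ≤ s → (ForkNew.zl p).up ≤ s →
      s ⊓ S.i ⊔ S.o = S.al := by
    intro p s hs hps
    have hps' := le_inf hps (ForkNew.zl p).up_le
    refine le_antisymm (sup_le ?_ hSq.bot_covBy_left.le) ?_
    · refine (hS.le_side hs).resolve_right fun hle => ?_
      exact (ForkNew.zl p).not_up_le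
        (hSq.inf_eq ▸ le_inf (ForkNew.up_zl_le p) (hps'.trans hle))
    · exact (ForkNew.up_zl_sup p).ge.trans (sup_le_sup_right hps' _)
  have right_side : ∀ {p : Wing S.ar S.o} {s : L}, ¬ S.i ≤ s → (ForkNew.zr p).up ≤ s →
      s ⊓ S.i ⊔ S.o = S.ar := by
    intro p s hs hps
    have hps' := le_inf hps (ForkNew.zr p).up_le
    refine le_antisymm (sup_le ?_ hSq.bot_covBy_right.le) ?_
    · refine (hS.le_side hs).resolve_left fun hle => ?_
      exact (ForkNew.zr p).not_up_le
        (hSq.inf_eq ▸ le_inf (hps'.trans hle) (ForkNew.up_zr_le p))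
    · exact (ForkNew.up_zr_sup p).ge.trans (sup_le_sup_right hps' _)
  -- If the two meets lay in different wings, this congruence would read `aₗ ≡ aᵣ` in one order or
  -- the other, contradicting separation.
  have hside := c.sup (c.inf hcinf (c.refl S.i)) (c.refl S.o)
  by_cases hwt : w = .t
  · rw [hwt, htw'.2 (htt.1 (htw.1 hwt))]
  have hwt' : w' ≠ .t := fun e => hwt (htw.2 (htt.2 (htw'.1 e)))
  have hx := fun hx => hwt (htw.2 hx)
  have hy := fun hy => hwt' (htw'.2 hy)
  have hux := up_le hw
  have huy := up_le hw'
  cases w with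
  | t => exact absurd rfl hwt
  | zl p =>
    cases w' with
    | t => exact absurd rfl hwt'
    | zl q => exact hcomp hwt hwt' (ForkNew.zl_total p q) hlow
    | zr q =>
      rw [left_side hx hux, right_side hy huy] at hside
      exact absurd hside hc.not_left_right
  | zr p =>
    cases w' with
    | t => exact absurd rfl hwt'
    | zl q =>
      rw [right_side hx hux, left_side hy huy] at hside
      exact absurd (c.symm hside) hc.not_left_right
    | zr q => exact hcomp hwt hwt' (ForkNew.zr_total p q) hlow

end ExtRel

/-- The extension to `L[S]` of a congruence of `L` that separates the upper edges of `S`. -/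
def extend (hS : S.IsTight) (c : LatticeCon L) (hc : S.Separates c) : LatticeCon (Fork S) where
  r := ExtRel c
  iseqv := ⟨fun _ => ⟨Iff.rfl, c.refl _⟩, fun h => ⟨h.1.symm, c.symm h.2⟩,
    fun h h' => ⟨h.1.trans h'.1, c.trans h.2 h'.2⟩⟩
  inf h h' := h.inf hS hc h'
  sup h h' := h.sup hc h'

/-- A prime interval of `L[S]` that the ideal generated by `t` cuts is collapsed by `γ(S)`. -/
theorem gamma_of_covBy {u v : Fork S} (huv : u ⋖ v) (hu : u ≤ new .t) (hv : ¬ v ≤ new .t) :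
    S.gamma.r u v := by
  -- Since `v` is not below `t`, it is old and not below `o`, so its meet with `i` cannot fall below
  -- `o`. Primality then forces `v ⊓ t = u` and `v ⊓ i = v`, and meeting the pair `t, i` with `v`
  -- yields `u, v`.
  have hvi : ¬ v ⊓ old S.i ≤ new .t := by
    intro hle
    obtain ⟨b, rfl⟩ := exists_eq_old fun hn => hv (le_t_iff.2 (.inl hn))
    rw [← old_inf] at hle
    exact hv (old_le_new.2 (S.le_bot_of_inf_top_le (old_le_new.1 hle)))
  have hti : (new .t : Fork S) ≤ old S.i := new_le_old.2 le_rfl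
  have h1 : v ⊓ new .t = u := by
    rcases huv.eq_or_eq (le_inf huv.le hu) inf_le_left with h | h
    · exact h
    · exact absurd (inf_eq_left.1 h) hv
  have h2 : v ⊓ old S.i = v := by
    rcases huv.eq_or_eq (le_inf huv.le (hu.trans hti)) inf_le_left with h | h
    · exact absurd (h ▸ hu) hvi
    · exact h
  have h3 := S.gamma.inf (S.gamma.refl v) (LatticeCon.con_self (new .t) (old S.i))
  rwa [h1, h2] at h3

end Fork

/-! ### The theorem -/

theorem theoremT {L : Type*} [Lattice L] [IsSPS L] (S : CoveringSquare L) (hS : S.IsTight) :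
    (∀ u v : L, u ⋖ v →
      S.gamma < LatticeCon.con (Fork.old u : Fork S) (Fork.old v) →
        S.alphaL ≤ LatticeCon.con u v ∨ S.alphaR ≤ LatticeCon.con u v) ∧
    (∀ u v : Fork S, u ⋖ v →
      S.gamma < LatticeCon.con u v →
        S.alphaLExt ≤ LatticeCon.con u v ∨ S.alphaRExt ≤ LatticeCon.con u v) := by
  constructor
  · intro u v _ hlt
    by_contra hcon
    push Not at hcon
    have hc : S.Separates (LatticeCon.con u v) :=
      ⟨fun h => hcon.1 (LatticeCon.con_le_iff.2 h), fun h => hcon.2 (LatticeCon.con_le_iff.2 h)⟩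
    have huv : LatticeCon.con (Fork.old u : Fork S) (Fork.old v) ≤ Fork.extend hS _ hc :=
      LatticeCon.con_le_iff.2 ⟨Iff.rfl, LatticeCon.con_self u v⟩
    -- The extension would collapse the new element `t` with the old element `i`.
    exact (LatticeCon.con_le_iff.1 (hlt.le.trans huv)).1.1 trivial
  · intro u v huv hlt
    by_contra hcon
    push Not at hcon
    have hc : S.Separates (Fork.restrict (LatticeCon.con u v)) :=
      ⟨fun h => hcon.1 (LatticeCon.con_le_iff.2 h), fun h => hcon.2 (LatticeCon.con_le_iff.2 h)⟩
    by_cases hiff : u ≤ Fork.new .t ↔ v ≤ Fork.new .t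
    · have hle : LatticeCon.con u v ≤ Fork.respectingT _ hc :=
        LatticeCon.con_le_iff.2 ⟨LatticeCon.con_self u v, hiff⟩
      -- Collapsing `t, i` here would put `i` below `t`.
      have h := (LatticeCon.con_le_iff.1 (hlt.le.trans hle)).2.1 le_rfl
      exact ForkNew.not_up_le_lo .t .t h
    · have hv : ¬ v ≤ Fork.new .t := fun hv => hiff (iff_of_true (huv.le.trans hv) hv)
      have hu : u ≤ Fork.new .t := by
        by_contra hu
        exact hiff (iff_of_false hu hv)
      exact hlt.not_ge (LatticeCon.con_le_iff.2 (Fork.gamma_of_covBy huv hu hv))
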